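/- Let $m\ge 1$ and $k\ge 0$ be integers. Let $\mathbb R_m$ be the real Clifford algebra generated by $e_1,\dots,e_m$ with $e_j^2=-1$ and $e_ie_j=-e_je_i$ for $i\ne j$. Let $\lambda\mapsto\bar\lambda$ be its real-linear anti-automorphism with $\overline{e_j}=-e_j$, let $[\lambda]_0$ denote the scalar part of $\lambda$, and put $|\lambda|^2=[\bar\lambda\lambda]_0$. For a differentiable function $f:\mathbb R^m\to\mathbb R$ let $\partial_x f=\sum_{j=1}^m e_j\,\frac{\partial f}{\partial x_j}$ be the Dirac operator, and for $F:\mathbb R^m\to\mathbb R_m$ let $\|F\|_{L^2(S^{m-1})}^2=\int_{S^{m-1}}|F(\omega)|^2\,d\omega$, where $d\omega$ is the surface measure on the unit sphere $S^{m-1}$ (counting measure on $S^0=\{\pm1\}$ if $m=1$). Let $\psi:\mathbb R^m\to\mathbb R$ be a real-valued spherical harmonic of degree $k$, that is, a harmonic function given by a homogeneous polynomial of degree $k$ with real coefficients (the zero function is allowed). Then $|\partial_x\psi|^2$ and $\psi^2$ are integrable over $S^{m-1}$ and $$\|\partial_x\psi\|_{L^2(S^{m-1})}^2=k(2k+m-2)\int_{S^{m-1}}\psi(\omega)^2\,d\omega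 .$$ -/

import Mathlib

open MeasureTheory

noncomputable section

/-- The standard negative definite form `v ↦ -(v₁² + ⋯ + vₘ²)` on `ℝᵐ`. -/
def negSq (m : ℕ) : QuadraticForm ℝ (Fin m → ℝ) :=
  QuadraticMap.weightedSumSquares ℝ (fun _ : Fin m => (-1 : ℝ))

/-- The real Clifford algebra `ℝₘ`, generated by `e₁, …, eₘ` with `eⱼ² = -1` and
`eᵢ eⱼ = -eⱼ eᵢ` for `i ≠ j`. -/
abbrev RealClifford (m : ℕ) : Type := CliffordAlgebra (negSq m)

namespace RealClifford

/-- The generator `eⱼ`. -/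
def gen {m : ℕ} (j : Fin m) : RealClifford m :=
  CliffordAlgebra.ι (negSq m) (Pi.single j 1)

/-- The scalar part `[a]₀`, i.e. the coefficient of `e_∅ = 1` of `a = ∑ A, a_A e_A`: the linear
isomorphism with the exterior algebra sends `e_A` (a product of orthogonal vectors) to the
corresponding wedge product, and `algebraMapInv` is the projection to degree `0` there. -/
def scalarPart {m : ℕ} (a : RealClifford m) : ℝ :=
  ExteriorAlgebra.algebraMapInv (CliffordAlgebra.equivExterior (negSq m) a)

/-- `|a|² = [ā a]₀`. Here `star` is Mathlib's Clifford conjugation, the real linear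
anti-automorphism with `star eⱼ = -eⱼ`. -/
def normSq {m : ℕ} (a : RealClifford m) : ℝ :=
  scalarPart (star a * a)

theorem gen_mul_self {m : ℕ} (j : Fin m) : gen j * gen j = (-1 : RealClifford m) := by
  have h : negSq m (Pi.single j 1) = -1 := by simp [negSq, Pi.single_apply]
  rw [gen, CliffordAlgebra.ι_sq_scalar, h, map_neg, map_one]

theorem gen_mul_gen {m : ℕ} {i j : Fin m} (h : i ≠ j) :
    gen i * gen j = -(gen j * gen i : RealClifford m) := by
  have hp : QuadraticMap.polar (negSq m) (Pi.single i 1) (Pi.single j 1) = 0 := by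
    simp only [QuadraticMap.polar, negSq, QuadraticMap.weightedSumSquares_apply, Pi.add_apply,
      ← Finset.sum_sub_distrib]
    refine Finset.sum_eq_zero fun l _ => ?_
    by_cases h1 : l = i
    · subst h1; simp [h]
    · simp [Pi.single_apply, h1]
  have := CliffordAlgebra.ι_mul_ι_add_swap (Q := negSq m) (Pi.single i 1) (Pi.single j 1)
  rw [hp, map_zero] at this
  exact eq_neg_of_add_eq_zero_left this

end RealClifford

/-- The Dirac operator `∂ₓ f = ∑ⱼ eⱼ ∂f/∂xⱼ` applied to a real-valued function `f` on `ℝᵐ`. -/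
def dirac {m : ℕ} (f : EuclideanSpace ℝ (Fin m) → ℝ) (x : EuclideanSpace ℝ (Fin m)) :
    RealClifford m :=
  ∑ j : Fin m, RealClifford.gen j *
    algebraMap ℝ (RealClifford m) (lineDeriv ℝ f x (EuclideanSpace.single j 1))

/-- The surface measure on the unit sphere `S^{m-1}` of `ℝᵐ`. -/
def sphereMeasure (m : ℕ) : Measure (Metric.sphere (0 : EuclideanSpace ℝ (Fin m)) 1) :=
  (volume : Measure (EuclideanSpace ℝ (Fin m))).toSphere

/-- The norm of `L²(S^{m-1})` for a Clifford-algebra-valued function, restricted to the sphere. -/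
def sphereL2Norm {m : ℕ} (F : EuclideanSpace ℝ (Fin m) → RealClifford m) : ℝ :=
  Real.sqrt (∫ ω : Metric.sphere (0 : EuclideanSpace ℝ (Fin m)) 1,
    RealClifford.normSq (F ω) ∂(sphereMeasure m))

/-- `ψ` is a real-valued spherical harmonic of degree `k` on `ℝᵐ`: a harmonic function that is
given by a homogeneous polynomial of degree `k`. -/
def IsSphericalHarmonic {m : ℕ} (k : ℕ) (ψ : EuclideanSpace ℝ (Fin m) → ℝ) : Prop :=
  (∃ p : MvPolynomial (Fin m) ℝ, p.IsHomogeneous k ∧ ∀ x, ψ x = MvPolynomial.eval (fun i => x i) p) ∧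
    InnerProductSpace.HarmonicOnNhd ψ Set.univ

end

/-!
For `f` homogeneous of degree `s` on a Euclidean space of dimension `d`, integrate `∂ᵥ f` by parts
against the Gaussian `exp (-‖x‖²)`. In polar coordinates both sides factor into an integral over the
unit sphere `S` and a Gamma function, and the recursion of `Γ` turns the identity into
`∫_S ∂ᵥ f = (d + s - 1) ∫_S ⟪x, v⟫ f`. Take `f = ψ ∂ⱼψ`, of degree `2k - 1`, and sum over `j`: since
`Δψ = 0` the left side becomes `∫_S |∇ψ|²`, and Euler's relation `∑ⱼ xⱼ ∂ⱼψ = k ψ` turns the right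
side into `(d + 2k - 2) k ∫_S ψ²`. Finally `|∂ₓψ|² = |∇ψ|²` in the Clifford algebra, as `∂ₓψ` is the
vector `∇ψ`.
-/

open Set Metric Module
open scoped RealInnerProductSpace

section VolumeIoiPow

variable {F : Type*} [NormedAddCommGroup F] [NormedSpace ℝ F]

theorem integrable_volumeIoiPow_iff {n : ℕ} {g : ℝ → F} :
    Integrable (fun r : Ioi (0 : ℝ) => g r) (Measure.volumeIoiPow n) ↔
      IntegrableOn (fun r : ℝ => r ^ n • g r) (Ioi 0) := by
  rw [Measure.volumeIoiPow, integrable_withDensity_iff_integrable_smul' (by fun_prop) (by simp),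
    integrableOn_iff_comap_subtypeVal measurableSet_Ioi]
  refine integrable_congr (.of_forall fun r => ?_)
  simp only [Function.comp_apply, ENNReal.toReal_ofReal (pow_nonneg (le_of_lt r.2) n)]

theorem integral_volumeIoiPow (n : ℕ) (g : ℝ → F) :
    ∫ r : Ioi (0 : ℝ), g r ∂(Measure.volumeIoiPow n) = ∫ r in Ioi (0 : ℝ), r ^ n • g r := by
  rw [Measure.volumeIoiPow, integral_withDensity_eq_integral_toReal_smul (by fun_prop) (by simp),
    ← integral_subtype_comap measurableSet_Ioi fun r : ℝ => r ^ n • g r]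
  refine integral_congr_ae (.of_forall fun r => ?_)
  simp only [ENNReal.toReal_ofReal (pow_nonneg (le_of_lt r.2) n)]

end VolumeIoiPow

theorem integrable_toSphere_of_continuous {E F : Type*} [NormedAddCommGroup E] [NormedSpace ℝ E]
    [FiniteDimensional ℝ E] [MeasurableSpace E] [BorelSpace E] (μ : Measure E)
    [μ.IsAddHaarMeasure] [NormedAddCommGroup F] {f : E → F} (hf : Continuous f) :
    Integrable (fun ω : sphere (0 : E) 1 => f ω) μ.toSphere :=
  (hf.comp continuous_subtype_val).integrable_of_hasCompactSupport (.of_compactSpace _)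

theorem pow_sub_one_mul_rpow_mul {d : ℕ} (hd : 0 < d) {r : ℝ} (hr : 0 < r) (s y : ℝ) :
    r ^ (d - 1) * (r ^ s * y) = r ^ (d + s - 1) * y := by
  rw [← mul_assoc, ← Real.rpow_natCast, ← Real.rpow_add hr, Nat.cast_pred hd]
  ring_nf

/-- Positive homogeneity of real degree `s`. Nothing is asked about scaling by `0`, so that negative
degrees are allowed. -/
def IsPosHomogeneous {E : Type*} [SMul ℝ E] (s : ℝ) (f : E → ℝ) : Prop :=
  ∀ ⦃r : ℝ⦄, 0 < r → ∀ x, f (r • x) = r ^ s * f x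

namespace IsPosHomogeneous

theorem mul {E : Type*} [SMul ℝ E] {s t : ℝ} {f g : E → ℝ} (hf : IsPosHomogeneous s f)
    (hg : IsPosHomogeneous t g) : IsPosHomogeneous (s + t) fun x => f x * g x := fun r hr x => by
  simp only [hf hr x, hg hr x, Real.rpow_add hr]
  ring

theorem of_hasLineDerivAt {E : Type*} [AddCommGroup E] [Module ℝ E] {s : ℝ} {f f' : E → ℝ} {v : E}
    (hf : IsPosHomogeneous s f) (hf' : ∀ x, HasLineDerivAt ℝ f (f' x) x v) :
    IsPosHomogeneous (s - 1) f' := fun r hr x => by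
  have hscale : (fun t : ℝ => f (r • x + t • v)) = fun t => r ^ s * f (x + (r⁻¹ * t) • v) := by
    ext t
    rw [← hf hr, smul_add, smul_smul, mul_inv_cancel_left₀ hr.ne']
  have hderiv : HasDerivAt (fun t : ℝ => f (r • x + t • v)) (r ^ s * (f' x * r⁻¹)) 0 := by
    have hinner : HasDerivAt (fun t : ℝ => f (x + t • v)) (f' x) (r⁻¹ * 0) := by
      rw [mul_zero]
      exact hf' x
    rw [hscale]
    exact ((hinner.comp 0 ((hasDerivAt_id 0).const_mul r⁻¹)).const_mul (r ^ s)).congr_deriv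
      (by rw [mul_one])
  rw [(hf' (r • x)).unique hderiv, Real.rpow_sub_one hr.ne']
  ring

section PolarCoordinates

variable {E : Type*} [NormedAddCommGroup E] [NormedSpace ℝ E] {s : ℝ} {f : E → ℝ}

theorem mul_fun_norm_eq (hf : IsPosHomogeneous s f) (g : ℝ → ℝ) (x : ({0}ᶜ : Set E)) :
    f x * g ‖x.1‖ =
      f (homeomorphUnitSphereProd E x).1 *
        ((homeomorphUnitSphereProd E x).2.1 ^ s * g (homeomorphUnitSphereProd E x).2.1) := by
  have hx : 0 < ‖x.1‖ := norm_pos_iff.2 x.2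
  simp only [homeomorphUnitSphereProd_apply_fst_coe, homeomorphUnitSphereProd_apply_snd_coe]
  conv_lhs => rw [← smul_inv_smul₀ hx.ne' x.1, hf hx, smul_inv_smul₀ hx.ne' x.1]
  ring

variable [Nontrivial E] [FiniteDimensional ℝ E] [MeasurableSpace E] [BorelSpace E]
  (μ : Measure E) [μ.IsAddHaarMeasure]

theorem integrable_mul_fun_norm (hf : IsPosHomogeneous s f) {g : ℝ → ℝ}
    (hfS : Integrable (fun ω : sphere (0 : E) 1 => f ω) μ.toSphere)
    (hg : IntegrableOn (fun r => r ^ (finrank ℝ E - 1) * (r ^ s * g r)) (Ioi 0)) :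
    Integrable (fun x => f x * g ‖x‖) μ := by
  have hprod := hfS.mul_prod (integrable_volumeIoiPow_iff.2 hg)
  rw [← μ.measurePreserving_homeomorphUnitSphereProd.integrable_comp_emb
    (Homeomorph.measurableEmbedding _)] at hprod
  rw [← restrict_compl_singleton (μ := μ) (0 : E), ← IntegrableOn,
    integrableOn_iff_comap_subtypeVal (measurableSet_singleton _).compl]
  exact hprod.congr (.of_forall fun x => (hf.mul_fun_norm_eq g x).symm)

theorem integral_mul_fun_norm (hf : IsPosHomogeneous s f) (g : ℝ → ℝ) :
    ∫ x, f x * g ‖x‖ ∂μ =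
      (∫ ω : sphere (0 : E) 1, f ω ∂μ.toSphere) *
        ∫ r in Ioi (0 : ℝ), r ^ (finrank ℝ E - 1) * (r ^ s * g r) :=
  calc
    ∫ x, f x * g ‖x‖ ∂μ = ∫ x : ({0}ᶜ : Set E), f x * g ‖x.1‖ ∂(μ.comap (↑)) := by
      rw [integral_subtype_comap (measurableSet_singleton _).compl fun x => f x * g ‖x‖,
        restrict_compl_singleton]
    _ = ∫ z : sphere (0 : E) 1 × Ioi (0 : ℝ), f z.1 * (z.2.1 ^ s * g z.2)
          ∂(μ.toSphere.prod (Measure.volumeIoiPow (finrank ℝ E - 1))) := by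
      rw [← μ.measurePreserving_homeomorphUnitSphereProd.integral_comp
        (Homeomorph.measurableEmbedding _)]
      exact integral_congr_ae (.of_forall (hf.mul_fun_norm_eq g))
    _ = _ := by
      rw [integral_prod_mul (fun ω : sphere (0 : E) 1 => f ω)
        fun r : Ioi (0 : ℝ) => r.1 ^ s * g r,
        integral_volumeIoiPow _ fun r => r ^ s * g r]
      rfl

theorem integrable_mul_exp_neg_norm_sq (hf : IsPosHomogeneous s f) (hs : 0 < finrank ℝ E + s)
    (hfS : Integrable (fun ω : sphere (0 : E) 1 => f ω) μ.toSphere) :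
    Integrable (fun x => f x * Real.exp (-‖x‖ ^ 2)) μ := by
  refine hf.integrable_mul_fun_norm μ (g := fun r => Real.exp (-r ^ 2)) hfS ?_
  refine IntegrableOn.congr_fun ?_ (fun r hr => (pow_sub_one_mul_rpow_mul finrank_pos hr s _).symm)
    measurableSet_Ioi
  simpa only [neg_mul, one_mul] using
    integrableOn_rpow_mul_exp_neg_mul_sq one_pos (s := finrank ℝ E + s - 1) (by linarith)

theorem integral_mul_exp_neg_norm_sq (hf : IsPosHomogeneous s f) (hs : 0 < finrank ℝ E + s) :
    ∫ x, f x * Real.exp (-‖x‖ ^ 2) ∂μ =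
      (∫ ω : sphere (0 : E) 1, f ω ∂μ.toSphere) * (Real.Gamma ((finrank ℝ E + s) / 2) / 2) := by
  rw [hf.integral_mul_fun_norm μ fun r => Real.exp (-r ^ 2),
    setIntegral_congr_fun measurableSet_Ioi
      fun r hr => pow_sub_one_mul_rpow_mul finrank_pos hr s _]
  have hΓ := integral_rpow_mul_exp_neg_rpow (p := 2) (q := finrank ℝ E + s - 1) two_pos
    (by linarith)
  simp only [Real.rpow_two, sub_add_cancel, one_div_mul_eq_div] at hΓ
  rw [hΓ]

end PolarCoordinates

end IsPosHomogeneous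

section InnerProductSpace

variable {E : Type*} [NormedAddCommGroup E] [InnerProductSpace ℝ E]

theorem isPosHomogeneous_inner_left (v : E) : IsPosHomogeneous 1 fun x : E => ⟪x, v⟫ :=
  fun r _ x => by simp only [real_inner_smul_left, Real.rpow_one]

theorem hasLineDerivAt_exp_neg_norm_sq (x v : E) :
    HasLineDerivAt ℝ (fun y : E => Real.exp (-‖y‖ ^ 2))
      (-2 * ⟪x, v⟫ * Real.exp (-‖x‖ ^ 2)) x v := by
  convert! (hasStrictFDerivAt_norm_sq x).hasFDerivAt.neg.exp.hasLineDerivAt v using 1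
  simp only [smul_apply, neg_apply, Pi.neg_apply, innerSL_apply_apply,
    smul_eq_mul, nsmul_eq_mul, Nat.cast_ofNat]
  ring

variable [FiniteDimensional ℝ E] [MeasurableSpace E] [BorelSpace E] (μ : Measure E)
  [μ.IsAddHaarMeasure] {f f' : E → ℝ} {v : E}

theorem integral_lineDeriv_mul_exp_neg_norm_sq
    (hf : ∀ x, HasLineDerivAt ℝ f (f' x) x v)
    (hint : Integrable (fun x => f x * Real.exp (-‖x‖ ^ 2)) μ)
    (hint' : Integrable (fun x => f' x * Real.exp (-‖x‖ ^ 2)) μ)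
    (hint_inner : Integrable (fun x => ⟪x, v⟫ * f x * Real.exp (-‖x‖ ^ 2)) μ) :
    ∫ x, f' x * Real.exp (-‖x‖ ^ 2) ∂μ = 2 * ∫ x, ⟪x, v⟫ * f x * Real.exp (-‖x‖ ^ 2) ∂μ := by
  have hrearrange (x : E) : f x * (-2 * ⟪x, v⟫ * Real.exp (-‖x‖ ^ 2)) =
      -2 * (⟪x, v⟫ * f x * Real.exp (-‖x‖ ^ 2)) := by ring
  have hparts := integral_bilinear_hasLineDerivAt_right_eq_neg_left_of_integrable (μ := μ)
    (B := ContinuousLinearMap.mul ℝ ℝ) hint'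
    ((hint_inner.const_mul (-2)).congr (.of_forall fun x => (hrearrange x).symm))
    hint (fun x _ => hf x) (fun x _ => hasLineDerivAt_exp_neg_norm_sq x v)
  simp only [ContinuousLinearMap.mul_apply', hrearrange, integral_const_mul] at hparts
  linarith

/-- With `d = dim E`, the factor `d + s - 1 = 2 Γ((d + s + 1) / 2) / Γ((d + s - 1) / 2)` is a
quotient of two radial Gaussian integrals. -/
theorem IsPosHomogeneous.integral_toSphere_lineDeriv [Nontrivial E] {s : ℝ}
    (hs : 0 < finrank ℝ E + s - 1) (hf : IsPosHomogeneous s f) (hfc : Continuous f)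
    (hf' : ∀ x, HasLineDerivAt ℝ f (f' x) x v) (hfc' : Continuous f') :
    ∫ ω : sphere (0 : E) 1, f' ω ∂μ.toSphere =
      (finrank ℝ E + s - 1) * ∫ ω : sphere (0 : E) 1, ⟪ω.1, v⟫ * f ω ∂μ.toSphere := by
  have hhom' := hf.of_hasLineDerivAt hf'
  have hhom_inner := (isPosHomogeneous_inner_left v).mul hf
  have hs' : 0 < finrank ℝ E + (s - 1) := by linarith
  have hs_inner : 0 < finrank ℝ E + (1 + s) := by linarith
  have hparts := integral_lineDeriv_mul_exp_neg_norm_sq μ hf'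
    (hf.integrable_mul_exp_neg_norm_sq μ (by linarith) (integrable_toSphere_of_continuous μ hfc))
    (hhom'.integrable_mul_exp_neg_norm_sq μ hs' (integrable_toSphere_of_continuous μ hfc'))
    (hhom_inner.integrable_mul_exp_neg_norm_sq μ hs_inner
      (integrable_toSphere_of_continuous μ
        ((continuous_id.inner continuous_const).mul hfc)))
  rw [hhom'.integral_mul_exp_neg_norm_sq μ hs',
    hhom_inner.integral_mul_exp_neg_norm_sq μ hs_inner] at hparts
  have hΓ_rec : Real.Gamma ((finrank ℝ E + (1 + s)) / 2) =
      (finrank ℝ E + (s - 1)) / 2 * Real.Gamma ((finrank ℝ E + (s - 1)) / 2) := by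
    rw [← Real.Gamma_add_one (half_pos hs').ne']
    ring_nf
  have hΓ_pos := Real.Gamma_pos_of_pos (half_pos hs')
  rw [hΓ_rec] at hparts
  refine mul_right_cancel₀ (half_pos hΓ_pos).ne' (hparts.trans ?_)
  ring

end InnerProductSpace

section Polynomial

open MvPolynomial

theorem eval_smul_of_isHomogeneous {R σ : Type*} [CommSemiring R] {p : MvPolynomial σ R} {n : ℕ}
    (hp : p.IsHomogeneous n) (r : R) (x : σ → R) : eval (r • x) p = r ^ n * eval x p := by
  rw [eval_eq, eval_eq, Finset.mul_sum]
  refine Finset.sum_congr rfl fun d hd => ?_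
  simp only [Pi.smul_apply, smul_eq_mul, mul_pow, Finset.prod_mul_distrib,
    Finset.prod_pow_eq_pow_sum, hp.degree_eq_sum_deg_support hd]
  ring

variable {ι : Type*}

theorem isPosHomogeneous_eval_of_isHomogeneous {p : MvPolynomial ι ℝ} {n : ℕ}
    (hp : p.IsHomogeneous n) :
    IsPosHomogeneous n fun x : EuclideanSpace ℝ ι => eval x.ofLp p := fun r _ x => by
  simp only [Real.rpow_natCast, WithLp.ofLp_smul, eval_smul_of_isHomogeneous hp]

theorem hasFDerivAt_eval_mvPolynomial [Fintype ι] {𝕜 : Type*} [NontriviallyNormedField 𝕜]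
    (p : MvPolynomial ι 𝕜) (x : ι → 𝕜) :
    HasFDerivAt (fun y => eval y p)
      (∑ i, eval x (pderiv i p) • (ContinuousLinearMap.proj i : (ι → 𝕜) →L[𝕜] 𝕜)) x := by
  classical
  induction p using MvPolynomial.induction_on with
  | C a =>
    simp only [eval_C]
    exact (hasFDerivAt_const a x).congr_fderiv (ContinuousLinearMap.ext fun v => by simp)
  | add p q hp hq =>
    simp only [map_add]
    refine (hp.fun_add hq).congr_fderiv (ContinuousLinearMap.ext fun v => ?_)
    simp [add_mul, Finset.sum_add_distrib]
  | mul_X p i hp =>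
    simp only [map_mul, eval_X]
    refine (hp.mul (hasFDerivAt_apply i x)).congr_fderiv (ContinuousLinearMap.ext fun v => ?_)
    simp [Derivation.leibniz, pderiv_X, Pi.single_apply, add_mul, Finset.sum_add_distrib,
      Finset.mul_sum, mul_assoc, apply_ite (eval x)]

theorem continuous_eval_mvPolynomial (p : MvPolynomial ι ℝ) :
    Continuous fun x : EuclideanSpace ℝ ι => eval x.ofLp p :=
  p.continuous_eval.comp (PiLp.continuous_ofLp 2 _)

theorem hasLineDerivAt_eval_mvPolynomial [Finite ι] [DecidableEq ι] (p : MvPolynomial ι ℝ) (i : ι)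
    (x : EuclideanSpace ℝ ι) :
    HasLineDerivAt ℝ (fun y : EuclideanSpace ℝ ι => eval y.ofLp p) (eval x.ofLp (pderiv i p)) x
      (EuclideanSpace.single i 1) := by
  have := Fintype.ofFinite ι
  have hcomp := (hasFDerivAt_eval_mvPolynomial p x.ofLp).comp x
    (EuclideanSpace.equiv ι ℝ).hasFDerivAt
  convert! hcomp.hasLineDerivAt (EuclideanSpace.single i 1) using 1
  simp

variable [Fintype ι]

theorem contDiff_eval_mvPolynomial (p : MvPolynomial ι ℝ) {n : WithTop ℕ∞} :
    ContDiff ℝ n fun x : EuclideanSpace ℝ ι => eval x.ofLp p :=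
  (AnalyticOnNhd.eval_continuousLinearMap (EuclideanSpace.equiv ι ℝ).toContinuousLinearMap
    p).contDiff

theorem laplacian_eval_mvPolynomial (p : MvPolynomial ι ℝ) (x : EuclideanSpace ℝ ι) :
    Laplacian.laplacian (fun y : EuclideanSpace ℝ ι => eval y.ofLp p) x =
      eval x.ofLp (∑ i, pderiv i (pderiv i p)) := by
  classical
  have hfderiv (q : MvPolynomial ι ℝ) (i : ι) (y : EuclideanSpace ℝ ι) :
      fderiv ℝ (fun z : EuclideanSpace ℝ ι => eval z.ofLp q) y (EuclideanSpace.single i 1) =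
        eval y.ofLp (pderiv i q) := by
    have hq := (contDiff_eval_mvPolynomial q (n := 1)).differentiable one_ne_zero y
    rw [← hq.lineDeriv_eq_fderiv]
    exact (hasLineDerivAt_eval_mvPolynomial q i y).lineDeriv
  have hdiff := ((contDiff_eval_mvPolynomial p (n := 2)).fderiv_right (m := 1)
    le_rfl).differentiable one_ne_zero x
  rw [InnerProductSpace.laplacian_eq_iteratedFDeriv_orthonormalBasis _
    (EuclideanSpace.basisFun ι ℝ), map_sum]
  refine Finset.sum_congr rfl fun i _ => ?_
  rw [iteratedFDeriv_two_apply, ← hfderiv (pderiv i p) i x]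
  simp only [← hfderiv p i, fderiv_clm_apply hdiff (differentiableAt_const _)]
  simp

theorem sum_pderiv_pderiv_eq_zero_of_harmonicOnNhd {p : MvPolynomial ι ℝ}
    (hp : InnerProductSpace.HarmonicOnNhd (fun x : EuclideanSpace ℝ ι => eval x.ofLp p) univ) :
    ∑ i, pderiv i (pderiv i p) = 0 :=
  MvPolynomial.funext fun x => by
    have hΔ := (hp (WithLp.toLp 2 x) (mem_univ _)).2.eq_of_nhds
    simpa only [laplacian_eval_mvPolynomial, Pi.zero_apply, map_zero] using hΔ

theorem integrable_toSphere_eval_mvPolynomial (p : MvPolynomial ι ℝ) :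
    Integrable (fun ω : sphere (0 : EuclideanSpace ℝ ι) 1 => eval ω.1.ofLp p)
      (volume : Measure (EuclideanSpace ℝ ι)).toSphere :=
  integrable_toSphere_of_continuous _ (continuous_eval_mvPolynomial p)

theorem integral_toSphere_eval_pderiv {p : MvPolynomial ι ℝ} {n : ℕ} (hp : p.IsHomogeneous n)
    (i : ι) :
    ∫ ω : sphere (0 : EuclideanSpace ℝ ι) 1, eval ω.1.ofLp (pderiv i p)
        ∂(volume : Measure (EuclideanSpace ℝ ι)).toSphere =
      (Fintype.card ι + n - 1) *
        ∫ ω : sphere (0 : EuclideanSpace ℝ ι) 1, eval ω.1.ofLp (X i * p)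
          ∂(volume : Measure (EuclideanSpace ℝ ι)).toSphere := by
  classical
  have : Nonempty ι := ⟨i⟩
  have hcard : 1 ≤ Fintype.card ι := Fintype.card_pos
  obtain hpos | hzero : 1 < Fintype.card ι + n ∨ (Fintype.card ι = 1 ∧ n = 0) := by lia
  · have hpos' : (0 : ℝ) < Fintype.card ι + n - 1 := by
      rw [sub_pos]
      exact_mod_cast hpos
    have hdiv := (isPosHomogeneous_eval_of_isHomogeneous hp).integral_toSphere_lineDeriv volume
      (by rwa [finrank_euclideanSpace]) (continuous_eval_mvPolynomial p)
      (hasLineDerivAt_eval_mvPolynomial p i) (continuous_eval_mvPolynomial (pderiv i p))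
    simpa [EuclideanSpace.inner_single_right] using hdiv
  · obtain ⟨hcard_one, rfl⟩ := hzero
    rw [← totalDegree_zero_iff_isHomogeneous, totalDegree_eq_zero_iff_eq_C] at hp
    rw [hp, pderiv_C, hcard_one]
    simp

theorem integral_toSphere_eval_sum_pderiv {F : ι → MvPolynomial ι ℝ} {n : ℕ}
    (hF : ∀ i, (F i).IsHomogeneous n) :
    ∫ ω : sphere (0 : EuclideanSpace ℝ ι) 1, eval ω.1.ofLp (∑ i, pderiv i (F i))
        ∂(volume : Measure (EuclideanSpace ℝ ι)).toSphere =
      (Fintype.card ι + n - 1) *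
        ∫ ω : sphere (0 : EuclideanSpace ℝ ι) 1, eval ω.1.ofLp (∑ i, X i * F i)
          ∂(volume : Measure (EuclideanSpace ℝ ι)).toSphere := by
  simp only [map_sum]
  rw [integral_finsetSum _ fun i _ => integrable_toSphere_eval_mvPolynomial _,
    integral_finsetSum _ fun i _ => integrable_toSphere_eval_mvPolynomial _, Finset.mul_sum]
  exact Finset.sum_congr rfl fun i _ => integral_toSphere_eval_pderiv (hF i) i

/-- Green's identity, whose normal derivative is `k p` by Euler's relation. -/
theorem integral_toSphere_sum_pderiv_mul_pderiv_add {p q : MvPolynomial ι ℝ} {k l : ℕ}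
    (hp : p.IsHomogeneous k) (hq : q.IsHomogeneous l) :
    ∫ ω : sphere (0 : EuclideanSpace ℝ ι) 1,
        eval ω.1.ofLp (∑ i, pderiv i q * pderiv i p + q * ∑ i, pderiv i (pderiv i p))
        ∂(volume : Measure (EuclideanSpace ℝ ι)).toSphere =
      k * (k + l + Fintype.card ι - 2) *
        ∫ ω : sphere (0 : EuclideanSpace ℝ ι) 1, eval ω.1.ofLp (q * p)
          ∂(volume : Measure (EuclideanSpace ℝ ι)).toSphere := by
  obtain _ | k := k
  · rw [← totalDegree_zero_iff_isHomogeneous, totalDegree_eq_zero_iff_eq_C] at hp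
    rw [hp]
    simp
  have hdiv : ∑ i, pderiv i (q * pderiv i p) =
      ∑ i, pderiv i q * pderiv i p + q * ∑ i, pderiv i (pderiv i p) := by
    rw [Finset.mul_sum, ← Finset.sum_add_distrib]
    refine Finset.sum_congr rfl fun i _ => ?_
    rw [Derivation.leibniz, smul_eq_mul, smul_eq_mul, add_comm, mul_comm (pderiv i p)]
  have heuler : ∑ i, X i * (q * pderiv i p) = C ((k + 1 : ℕ) : ℝ) * (q * p) := by
    calc
      ∑ i, X i * (q * pderiv i p) = q * ∑ i, X i * pderiv i p := by
        rw [Finset.mul_sum]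
        exact Finset.sum_congr rfl fun i _ => mul_left_comm _ _ _
      _ = C ((k + 1 : ℕ) : ℝ) * (q * p) := by
        rw [hp.sum_X_mul_pderiv, nsmul_eq_mul, map_natCast, mul_left_comm]
  rw [← hdiv, integral_toSphere_eval_sum_pderiv fun i => hq.mul hp.pderiv, heuler]
  simp only [map_mul (eval _) (C _), eval_C, integral_const_mul]
  push_cast [Nat.add_sub_cancel]
  ring

end Polynomial

namespace RealClifford

variable {m : ℕ}

theorem scalarPart_algebraMap (r : ℝ) : scalarPart (algebraMap ℝ (RealClifford m) r) = r := by
  rw [scalarPart, CliffordAlgebra.equivExterior, CliffordAlgebra.changeFormEquiv_apply,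
    CliffordAlgebra.changeForm_algebraMap]
  exact ExteriorAlgebra.algebraMap_leftInverse _ r

theorem normSq_ι (v : Fin m → ℝ) : normSq (CliffordAlgebra.ι (negSq m) v) = ∑ j, v j ^ 2 := by
  rw [normSq, CliffordAlgebra.star_ι, neg_mul, CliffordAlgebra.ι_sq_scalar, ← map_neg,
    scalarPart_algebraMap]
  simp [negSq, QuadraticMap.weightedSumSquares_apply, pow_two]

theorem sum_gen_mul_algebraMap (v : Fin m → ℝ) :
    ∑ j, gen j * algebraMap ℝ (RealClifford m) (v j) = CliffordAlgebra.ι (negSq m) v := by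
  conv_rhs => rw [pi_eq_sum_univ' v, map_sum]
  refine Finset.sum_congr rfl fun j _ => ?_
  rw [gen, map_smul, ← Algebra.commutes, Algebra.smul_def]

end RealClifford

section Dirac

variable {m : ℕ}

theorem normSq_dirac (f : EuclideanSpace ℝ (Fin m) → ℝ) (x : EuclideanSpace ℝ (Fin m)) :
    RealClifford.normSq (dirac f x) = ∑ j, lineDeriv ℝ f x (EuclideanSpace.single j 1) ^ 2 := by
  rw [dirac, RealClifford.sum_gen_mul_algebraMap, RealClifford.normSq_ι]

theorem normSq_dirac_eval_mvPolynomial (p : MvPolynomial (Fin m) ℝ)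
    (x : EuclideanSpace ℝ (Fin m)) :
    RealClifford.normSq (dirac (fun y => MvPolynomial.eval y.ofLp p) x) =
      MvPolynomial.eval x.ofLp (∑ j, MvPolynomial.pderiv j p * MvPolynomial.pderiv j p) := by
  simp only [normSq_dirac, (hasLineDerivAt_eval_mvPolynomial p _ x).lineDeriv, map_sum, map_mul,
    pow_two]

theorem sphereL2Norm_dirac_sq (f : EuclideanSpace ℝ (Fin m) → ℝ) :
    sphereL2Norm (dirac f) ^ 2 =
      ∫ ω : sphere (0 : EuclideanSpace ℝ (Fin m)) 1, RealClifford.normSq (dirac f ω)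
        ∂(sphereMeasure m) :=
  Real.sq_sqrt <| integral_nonneg fun ω => by
    simp only [Pi.zero_apply, normSq_dirac]
    positivity

end Dirac

theorem mainTheorem2 (m k : ℕ) (ψ : EuclideanSpace ℝ (Fin m) → ℝ)
    (hψ : IsSphericalHarmonic k ψ) :
    Integrable (fun ω : Metric.sphere (0 : EuclideanSpace ℝ (Fin m)) 1 =>
        RealClifford.normSq (dirac ψ ω)) (sphereMeasure m) ∧
    Integrable (fun ω : Metric.sphere (0 : EuclideanSpace ℝ (Fin m)) 1 => ψ ω ^ 2)
        (sphereMeasure m) ∧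
    sphereL2Norm (dirac ψ) ^ 2 =
      (k : ℝ) * (2 * (k : ℝ) + (m : ℝ) - 2) *
        ∫ ω : Metric.sphere (0 : EuclideanSpace ℝ (Fin m)) 1, ψ ω ^ 2 ∂(sphereMeasure m) := by
  obtain ⟨⟨p, hp, hψp⟩, hharm⟩ := hψ
  obtain rfl : ψ = fun x => MvPolynomial.eval x.ofLp p := funext hψp
  have hΔ : ∑ j, MvPolynomial.pderiv j (MvPolynomial.pderiv j p) = 0 :=
    sum_pderiv_pderiv_eq_zero_of_harmonicOnNhd hharm
  have hgreen := integral_toSphere_sum_pderiv_mul_pderiv_add hp hp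
  rw [hΔ, mul_zero, add_zero, Fintype.card_fin] at hgreen
  rw [sphereL2Norm_dirac_sq]
  simp only [normSq_dirac_eval_mvPolynomial, pow_two, ← map_mul]
  refine ⟨integrable_toSphere_eval_mvPolynomial _, integrable_toSphere_eval_mvPolynomial _, ?_⟩
  rw [two_mul (k : ℝ)]
  exact hgreen
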